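/- Let $(\Omega,\mathcal F,\mathbb P)$ be a probability space and $\mathcal D$ a finite set of detectors. Each $D\in\mathcal D$ has a measurable event $\{Y_D=P\}$ (its true label is positive), a measurable event $R_D(t)$ for each threshold $t\in\mathbb R$ (its internal rule fires), and a set of parents $\mathcal P(D)\subseteq\mathcal D$; the directed graph with edges $C\to D$ for $C\in\mathcal P(D)$ is acyclic. For a profile $\lambda=(\lambda_D)_{D\in\mathcal D}$ of thresholds, the operational detector $D^{\mathrm{op}}_\lambda$ is the event defined recursively along this graph as follows: $D^{\mathrm{op}}_\lambda$ occurs if and only if $R_D(\lambda_D)$ occurs and the gate of $D$ holds. The gate of $D$ is either AND (all $C^{\mathrm{op}}_\lambda$, $C\in\mathcal P(D)$, occur), or NOT (no $C^{\mathrm{op}}_\lambda$, $C\in\mathcal P(D)$, occurs), or a mixed gate (a Boolean function of the events $C^{\mathrm{op}}_\lambda$, $C\in\mathcal P(D)$, that is, in each of them separately, nondecreasing or nonincreasing). Put $$\mathrm{Prec}_{D^{\mathrm{op}}}(\lambda)=\frac{\mathbb P(\{Y_D=P\}\cap D^{\mathrm{op}}_\lambda)}{\mathbb P(D^{\mathrm{op}}_\lambda)},\qquad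 \mathrm{Rec}_{D^{\mathrm{op}}}(\lambda)=\frac{\mathbb P(\{Y_D=P\}\cap D^{\mathrm{op}}_\lambda)}{\mathbb P(Y_D=P)},$$ where a quotient with denominator $0$ is read as $0$ (the usual assumption is that the denominators are positive, and then this convention plays no role). For each $D\in\mathcal D$ let $\Lambda_D\subset\mathbb R$ be a nonempty compact interval, let $a_D,b_D\ge 0$ with $(a_D,b_D)\ne(0,0)$, and define the utility $$U_D(\lambda_D;\lambda_{-D})=a_D\,\mathrm{Prec}_{D^{\mathrm{op}}}(\lambda_D;\lambda_{-D})+b_D\,\mathrm{Rec}_{D^{\mathrm{op}}}(\lambda_D;\lambda_{-D}).$$ Assume that, for every $D$, the function $U_D$ is continuous on $\prod_{C\in\mathcal D}\Lambda_C$ and, for every fixed $\lambda_{-D}\in\prod_{C\ne D}\Lambda_C$, the function $U_D(\cdot\,;\lambda_{-D})$ is quasi-concave on $\Lambda_D$. Then the game with players $D\in\mathcal D$, strategy sets $\Lambda_D$ and payoffs $U_D$ has a pure-strategy Nash equilibrium: there is $\lambda^*\in\prod_{D}\Lambda_D$ such that, for every $D$ and every $t\in\Lambda_D$, $$U_D(t;\lambda^*_{-D})\le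 U_D(\lambda^*_D;\lambda^*_{-D}).$$ -/

import Mathlib

open MeasureTheory

noncomputable section

/-- A gate over a set `κ` of parents: the condition on the set of those parents that fire
operationally. `and`: all parents fire; `not`: no parent fires; `mixed g`: any Boolean function `g`
of the set of firing parents that is, in each parent separately, increasing or decreasing. -/
inductive Gate (κ : Type*) where
  | and : Gate κ
  | not : Gate κ
  | mixed (g : Set κ → Prop)
      (hg : ∀ c : κ, (∀ S : Set κ, g (S \ {c}) → g (insert c S)) ∨
        (∀ S : Set κ, g (insert c S) → g (S \ {c}))) : Gate κ

/-- The gate condition holds when `S` is the set of parents that fire. -/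
def Gate.Holds {κ : Type*} : Gate κ → Set κ → Prop
  | .and, S => ∀ c, c ∈ S
  | .not, S => ∀ c, c ∉ S
  | .mixed g _, S => g S

/-- A network of threshold detectors, indexed by `ι`, over a sample space `Ω`. -/
structure DetectionNetwork (ι Ω : Type*) [MeasurableSpace Ω] where
  /-- the set of detectors on which a detector is conditioned -/
  parents : ι → Set ι
  /-- the directed graph with an edge from `C` to `D` whenever `C` is a parent of `D` is acyclic -/
  acyclic : ∀ D, ¬ Relation.TransGen (fun C D => C ∈ parents D) D D
  /-- the gate of each detector over its parents -/
  gate : ∀ D, Gate (parents D)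
  /-- `rule D t` is the event that the internal rule of `D` is positive at threshold `t` -/
  rule : ι → ℝ → Set Ω
  measurableSet_rule : ∀ D t, MeasurableSet (rule D t)
  /-- `label D` is the event that the true class of the signal of `D` is positive -/
  label : ι → Set Ω
  measurableSet_label : ∀ D, MeasurableSet (label D)

namespace DetectionNetwork

variable {ι Ω : Type*} [MeasurableSpace Ω]

theorem wellFounded_parents [Finite ι] (G : DetectionNetwork ι Ω) :
    WellFounded (fun C D => C ∈ G.parents D) := by
  have : Std.Irrefl (Relation.TransGen (fun C D => C ∈ G.parents D)) := ⟨G.acyclic⟩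
  have h := Finite.wellFounded_of_trans_of_irrefl
    (Relation.TransGen (fun C D => C ∈ G.parents D))
  exact Subrelation.wf (r := Relation.TransGen (fun C D => C ∈ G.parents D))
    (fun h => Relation.TransGen.single h) h

/-- The event that `D` fires operationally at the threshold profile `l`: its internal rule is
positive and its gate holds for the set of parents that fire operationally. -/
def op [Finite ι] (G : DetectionNetwork ι Ω) (l : ι → ℝ) : ι → Set Ω :=
  G.wellFounded_parents.fix fun D opParent =>
    {ω | ω ∈ G.rule D (l D) ∧ (G.gate D).Holds {C | ω ∈ opParent C.1 C.2}}

theorem mem_op_iff [Finite ι] (G : DetectionNetwork ι Ω) (l : ι → ℝ) (D : ι) (ω : Ω) :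
    ω ∈ G.op l D ↔
      ω ∈ G.rule D (l D) ∧ (G.gate D).Holds {C : G.parents D | ω ∈ G.op l C} := by
  unfold op
  conv_lhs => rw [WellFounded.fix_eq]
  rfl

/-- Population precision of the operational detector, `P(Y = P, D = P) / P(D = P)`
(with value `0` if the detector almost surely never fires). -/
def opPrecision [Finite ι] (G : DetectionNetwork ι Ω) (μ : Measure Ω) (D : ι) (l : ι → ℝ) : ℝ :=
  μ.real (G.label D ∩ G.op l D) / μ.real (G.op l D)

/-- Population recall of the operational detector, `P(Y = P, D = P) / P(Y = P)`
(with value `0` if the label is almost surely never positive). -/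
def opRecall [Finite ι] (G : DetectionNetwork ι Ω) (μ : Measure Ω) (D : ι) (l : ι → ℝ) : ℝ :=
  μ.real (G.label D ∩ G.op l D) / μ.real (G.label D)

/-- The utility of detector `D` at the threshold profile `l`. -/
def utility [Finite ι] (G : DetectionNetwork ι Ω) (μ : Measure Ω) (a b : ι → ℝ) (D : ι)
    (l : ι → ℝ) : ℝ :=
  a D * G.opPrecision μ D l + b D * G.opRecall μ D l

end DetectionNetwork

/-- `x` is a pure-strategy Nash equilibrium of the game with players `ι`, strategy sets `S i` and
payoffs `U i`: it is an admissible profile, and no player gains by a unilateral deviation. -/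
def IsPureNashEquilibrium {ι : Type*} [DecidableEq ι] (S : ι → Set ℝ)
    (U : ι → (ι → ℝ) → ℝ) (x : ι → ℝ) : Prop :=
  (∀ i, x i ∈ S i) ∧ ∀ i, ∀ t ∈ S i, U i (Function.update x i t) ≤ U i x

end

/-!
Although the operational events of different detectors interact, the interaction follows an acyclic
graph: whether `D` fires operationally depends only on the thresholds of `D` and of its ancestors
(`DetectionNetwork.op_congr`), and hence so does the utility of `D`
(`DetectionNetwork.utility_congr`). The game is therefore triangular. Once the ancestors of `D`
have chosen their thresholds, `D` faces an ordinary maximization of a continuous function over a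
compact set, and nothing chosen afterwards by the other detectors affects it. Choosing a best
response by recursion along the ancestor relation gives an equilibrium
(`exists_isPureNashEquilibrium_of_wellFounded`), without any fixed point theorem.
-/

/-- A game in which the payoff of player `i` depends only on the strategy of `i` and on those of the
players below `i` in a well-founded relation has a pure-strategy Nash equilibrium, as soon as the
strategy sets are nonempty and compact and each payoff is continuous on the product. -/
theorem exists_isPureNashEquilibrium_of_wellFounded {ι : Type*} [DecidableEq ι]
    {r : ι → ι → Prop} (hr : WellFounded r) {S : ι → Set ℝ} {U : ι → (ι → ℝ) → ℝ}
    (hne : ∀ i, (S i).Nonempty) (hcpt : ∀ i, IsCompact (S i))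
    (hcont : ∀ i, ContinuousOn (U i) (Set.univ.pi S))
    (hU : ∀ i x y, x i = y i → (∀ j, r j i → x j = y j) → U i x = U i y) :
    ∃ x, IsPureNashEquilibrium S U x := by
  classical
  have hbest : ∀ i, ∀ x : ∀ j, S j, ∃ s : S i, ∀ t ∈ S i,
      U i (Function.update (fun j => (x j : ℝ)) i t) ≤
        U i (Function.update (fun j => (x j : ℝ)) i s) := by
    intro i x
    have hmaps : Set.MapsTo (fun t => Function.update (fun j => (x j : ℝ)) i t) (S i)
        (Set.univ.pi S) := by
      intro t ht j _
      rcases eq_or_ne j i with rfl | hj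
      · simpa using ht
      · simp [hj]
    have hupd : Continuous fun t : ℝ => Function.update (fun j => (x j : ℝ)) i t :=
      continuous_const.update i continuous_id
    obtain ⟨s, hs, hmax⟩ :=
      (hcpt i).exists_isMaxOn (hne i) ((hcont i).comp hupd.continuousOn hmaps)
    exact ⟨⟨s, hs⟩, fun t ht => hmax ht⟩
  choose best hbest using hbest
  let base : ∀ i, S i := fun i => ⟨(hne i).some, (hne i).some_mem⟩
  -- The players below `i` have already chosen; the others are given arbitrary admissible strategies.
  let extend : ∀ i, (∀ j, r j i → S j) → ∀ j, S j :=
    fun i prev j => if h : r j i then prev j h else base j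
  let x : ∀ i, S i := hr.fix fun i prev => best i (extend i prev)
  have hx : ∀ i, x i = best i (extend i fun j _ => x j) := fun i => hr.fix_eq _ i
  refine ⟨fun i => x i, fun i => (x i).2, fun i t ht => ?_⟩
  have hirr : ∀ j, r j i → j ≠ i := by
    rintro j hj rfl
    exact hr.irrefl.irrefl j hj
  have hagree : ∀ s : ℝ, U i (Function.update (fun j => (x j : ℝ)) i s) =
      U i (Function.update (fun j => (extend i (fun j _ => x j) j : ℝ)) i s) := by
    intro s
    refine hU i _ _ (by simp) fun j hj => ?_
    simp [hirr j hj, extend, hj]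
  have key := hbest i (extend i fun j _ => x j) t ht
  rw [← hx, ← hagree, ← hagree, Function.update_eq_self] at key
  exact key

namespace DetectionNetwork

variable {ι Ω : Type*} [MeasurableSpace Ω] [Finite ι]

theorem op_congr (G : DetectionNetwork ι Ω) {l l' : ι → ℝ} (D : ι) (hD : l D = l' D)
    (h : ∀ C, Relation.TransGen (fun C D => C ∈ G.parents D) C D → l C = l' C) :
    G.op l D = G.op l' D := by
  induction D using G.wellFounded_parents.induction with
  | _ D ih =>
    have hpar : ∀ C : G.parents D, G.op l C = G.op l' C := fun C =>
      ih C C.2 (h C (.single C.2)) fun B hB => h B (hB.tail C.2)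
    ext ω
    rw [mem_op_iff, mem_op_iff, hD]
    simp only [hpar]

theorem utility_congr (G : DetectionNetwork ι Ω) (μ : Measure Ω) (a b : ι → ℝ) {l l' : ι → ℝ}
    (D : ι) (hD : l D = l' D)
    (h : ∀ C, Relation.TransGen (fun C D => C ∈ G.parents D) C D → l C = l' C) :
    G.utility μ a b D l = G.utility μ a b D l' := by
  simp only [utility, opPrecision, opRecall, G.op_congr D hD h]

end DetectionNetwork

theorem theorem5 {ι Ω : Type*} [Finite ι] [DecidableEq ι] [MeasurableSpace Ω]
    (μ : Measure Ω) [IsProbabilityMeasure μ] (G : DetectionNetwork ι Ω)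
    (Λ : ι → Set ℝ) (hne : ∀ D, (Λ D).Nonempty) (hcpt : ∀ D, IsCompact (Λ D))
    (hconv : ∀ D, Convex ℝ (Λ D))
    (a b : ι → ℝ) (ha : ∀ D, 0 ≤ a D) (hb : ∀ D, 0 ≤ b D)
    (hab : ∀ D, (a D, b D) ≠ (0, 0))
    (hquasi : ∀ D, ∀ l ∈ Set.univ.pi Λ,
      QuasiconcaveOn ℝ (Λ D) (fun t => G.utility μ a b D (Function.update l D t)))
    (hcont : ∀ D, ContinuousOn (G.utility μ a b D) (Set.univ.pi Λ)) :
    ∃ l : ι → ℝ, IsPureNashEquilibrium Λ (G.utility μ a b) l :=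
  exists_isPureNashEquilibrium_of_wellFounded G.wellFounded_parents.transGen hne hcpt hcont
    fun D _ _ => G.utility_congr μ a b D
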